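/- **Conventions.** For a metric space $X$, $\dim_H X$ denotes its Hausdorff dimension, with $\dim_H\emptyset=-1$. The (small inductive) topological dimension is given by $\dim_t\emptyset=-1$ and, for $X\neq\emptyset$, $$\dim_t X=\inf\{d : X \text{ has a basis } \mathcal U \text{ such that } \dim_t\partial U\le d-1 \text{ for every } U\in\mathcal U\}.$$ The $n$th inductive topological Hausdorff dimension is given by $\dim_{t^nH}\emptyset=-1$ for all $n\in\mathbb N$, $\dim_{t^0H}X=\dim_H X$ and, for $n\ge 1$ and $X\ne\emptyset$, $$\dim_{t^nH}X=\inf\{d : X\text{ has a basis }\mathcal U\text{ such that }\dim_{t^{n-1}H}\partial U\le d-1\text{ for every }U\in\mathcal U\}.$$ In both infima $d=\infty$ is admitted, all these dimensions may be $\infty$, and $\infty-k=\infty$ for $k \in \mathbb N$. For a compact metric space $K$, $C_n(K)$ is the space of continuous maps $K\to\mathbb R^n$ with the supremum norm; a property holds for the generic $f\in C_n(K)$ if the set of $f$ having it is co-meager in $C_n(K)$. **Theorem (Main Theorem).** Let $n\ge 1$ be an integer and let $K$ be a compact metric space with $\dim_t K\ge n$. Then there exists a $G_\delta$ set $G\subseteq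 K$ with $\dim_H G=\dim_{t^nH}K-n$ such that for the generic $f\in C_n(K)$: (i) $\#(f^{-1}(y)\setminus G)\le n$ for all $y\in\mathbb R^n$, and thus $\dim_H f^{-1}(y)\le\dim_{t^nH}K-n$ for all $y\in\mathbb R^n$; (ii) for every real $d<\dim_{t^nH}K$ there exists a non-empty open ball $U_{f,d}\subseteq\mathbb R^n$ such that $\dim_H f^{-1}(y)\ge d-n$ for every $y\in U_{f,d}$. -/

import Mathlib

open TopologicalSpace

universe u

/-- Hausdorff dimension of a subset of a metric space, with the convention that the empty set
has dimension `-1` (Mathlib's `dimH` gives it dimension `0`). -/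
noncomputable def hausdorffDim {X : Type u} [MetricSpace X] (s : Set X) : EReal :=
  open Classical in if s = ∅ then -1 else ((dimH s : ENNReal) : EReal)

/-- The `n`th inductive topological Hausdorff dimension of a metric space: it is `-1` for the
empty space, the Hausdorff dimension for `n = 0`, and for non-empty spaces the infimum of all `d`
such that the space has a basis whose members have boundaries (with the induced metric) of
`n`th inductive topological Hausdorff dimension at most `d - 1`, for index `n + 1`.
The value `d = ∞` is always admitted, since `⊤ - 1 = ⊤`. -/
noncomputable def indTopHausdorffDim : ℕ → (X : Type u) → [MetricSpace X] → EReal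
  | 0, X, _ => hausdorffDim (Set.univ : Set X)
  | n + 1, X, _ =>
    open Classical in
    if IsEmpty X then -1
    else sInf {d : EReal | ∃ B : Set (Set X), IsTopologicalBasis B ∧
      ∀ U ∈ B, indTopHausdorffDim n (frontier U) ≤ d - 1}

/-!
Write a map into `ℝⁿ` as a tuple of `n` real functions.

*Large fibres.* If generic `n` functions had a common zero set of vanishing `h`-dimensional content,
then sets `{g < 0}` with `g` generic would form a basis whose boundaries inherit the property for
`n - 1` functions, and `dim_{tⁿH} K ≤ h + n` by induction. So if `h + n < dim_{tⁿH} K`, some tuple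
has, together with all tuples near it, common zeros of content bounded below. By compactness this
happens near some point `x₀` for arbitrarily small tuples, and such a tuple can be added to the
constant `f(x₀)` and glued into any given `f` near `x₀` by a small perturbation. Hence the maps all
of whose fibres over some open set have large `h`-content form a dense open set.

*Small fibres.* Choosing countable bases with boundaries of small dimension, one finds by induction
on `n` closed sets `F k` which are less than `n`-dimensional in the sense of covering dimension, and
whose union misses only a set of dimension at most `dim_{tⁿH} K - n`. At each scale `ε` a finite
union of the `F k` is covered by `n` closed sets that split into pieces of diameter at most `ε`;
perturbing the `i`th coordinate to separate the pieces of the `i`th set leaves, by the pigeonhole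
principle, no `n + 1` points of a fibre at mutual distances larger than `ε`.
-/

open MeasureTheory Set Metric Filter Topology
open scoped ENNReal NNReal

section Category

variable {X Y : Type*} [TopologicalSpace X] [TopologicalSpace Y] [SecondCountableTopology Y]

theorem eventually_residual_dense_section {U : Set (X × Y)} (hU : IsOpen U) (hUd : Dense U) :
    ∀ᶠ x in residual X, Dense {y | (x, y) ∈ U} := by
  have hV : ∀ V ∈ countableBasis Y, ∀ᶠ x in residual X, ∃ y ∈ V, (x, y) ∈ U := fun V hV => by
    have hVo := isOpen_of_mem_countableBasis hV
    have himage : {x | ∃ y ∈ V, (x, y) ∈ U} = Prod.fst '' (U ∩ univ ×ˢ V) := by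
      ext x
      simp [and_comm]
    refine residual_of_dense_open ?_ (dense_iff_inter_open.2 fun O hO hOne => ?_)
    · rw [himage]
      exact isOpenMap_fst _ (hU.inter (isOpen_univ.prod hVo))
    · obtain ⟨⟨x, y⟩, ⟨hx, hy⟩, hxy⟩ := hUd.inter_open_nonempty (O ×ˢ V) (hO.prod hVo)
        (hOne.prod (nonempty_of_mem_countableBasis hV))
      exact ⟨x, hx, y, hy, hxy⟩
  filter_upwards [(eventually_countable_ball (countable_countableBasis Y)).2 hV] with x hx
  exact (isBasis_countableBasis Y).dense_iff.2 fun V hV _ => hx V hV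

theorem eventually_residual_curry {p : X × Y → Prop} (hp : ∀ᶠ z in residual (X × Y), p z) :
    ∀ᶠ x in residual X, ∀ᶠ y in residual Y, p (x, y) := by
  obtain ⟨S, hSo, hSd, hSc, hS⟩ := mem_residual_iff.1 hp
  have hsection : ∀ U ∈ S, ∀ᶠ x in residual X, ∀ᶠ y in residual Y, (x, y) ∈ U := fun U hU => by
    filter_upwards [eventually_residual_dense_section (hSo U hU) (hSd U hU)] with x hx
    exact residual_of_dense_open ((hSo U hU).preimage (by fun_prop)) hx
  filter_upwards [(eventually_countable_ball hSc).2 hsection] with x hx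
  filter_upwards [(eventually_countable_ball hSc).2 hx] with y hy
  exact hS (mem_sInter.2 hy)

end Category

section Content

variable {X : Type*} [PseudoEMetricSpace X] {h : ℝ≥0} {E : Set X} {c : ℝ≥0∞}

/-- The `h`-dimensional Hausdorff content: the outer measure of `E` is the infimum of
`∑ (ediam (t i)) ^ h` over all countable covers of `E`, with no restriction on the diameters.
Unlike the Hausdorff measure, it is outer regular at finite values, and it has the same null
sets. For `h = 0` every non-empty set of a cover counts as `1`. -/
noncomputable def hausdorffContent (h : ℝ≥0) : OuterMeasure X :=
  OuterMeasure.boundedBy fun s => ediam s ^ (h : ℝ)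

theorem hausdorffContent_lt_iff :
    hausdorffContent h E < c ↔ ∃ t : ℕ → Set X, E ⊆ ⋃ i, t i ∧
      ∑' i, ⨆ _ : (t i).Nonempty, ediam (t i) ^ (h : ℝ) < c := by
  simp only [hausdorffContent, OuterMeasure.boundedBy_apply, iInf_lt_iff, exists_prop]

theorem eq_empty_of_hausdorffContent_zero_lt_one (hE : hausdorffContent 0 E < 1) : E = ∅ := by
  obtain ⟨t, htE, ht⟩ := hausdorffContent_lt_iff.1 hE
  refine subset_empty_iff.1 (htE.trans (iUnion_subset fun i => ?_))
  by_contra hne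
  rw [subset_empty_iff, ← ne_eq, ← nonempty_iff_ne_empty] at hne
  exact ((ENNReal.le_tsum i).trans_lt ht).not_ge (by simp [hne])

theorem hausdorffContent_image_of_isometry {Y : Type*} [PseudoEMetricSpace Y] {f : X → Y}
    (hf : Isometry f) (E : Set X) : hausdorffContent h (f '' E) = hausdorffContent h E := by
  have hmono : Monotone fun s : {s : Set Y // s.Nonempty} => ediam (s : Set Y) ^ (h : ℝ) :=
    fun s t hst => ENNReal.rpow_le_rpow (ediam_mono hst) h.coe_nonneg
  rw [← OuterMeasure.comap_apply, hausdorffContent, OuterMeasure.comap_boundedBy f (.inl hmono)]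
  simp only [hf.ediam_image, hausdorffContent]

theorem exists_ediam_thickening_rpow_lt {b : ℝ≥0∞} (hb : ediam E ^ (h : ℝ) < b) :
    ∃ r : ℝ, 0 < r ∧ ediam (thickening r E) ^ (h : ℝ) < b := by
  have hcont : ContinuousAt (fun r : ℝ≥0 => (ediam E + 2 * r) ^ (h : ℝ)) 0 :=
    (ENNReal.continuous_rpow_const.comp (continuous_const.add
      ((ENNReal.continuous_const_mul (by simp)).comp ENNReal.continuous_coe))).continuousAt
  obtain ⟨r, hrb, hr⟩ := (((hcont.eventually_lt_const (by simpa using hb)).filter_mono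
    (nhdsWithin_le_nhds (s := Ioi 0))).and self_mem_nhdsWithin).exists
  exact ⟨r, NNReal.coe_pos.2 hr, lt_of_le_of_lt
    (ENNReal.rpow_le_rpow (ediam_thickening_le r) h.coe_nonneg) hrb⟩

theorem exists_isOpen_superset_hausdorffContent_lt (hE : hausdorffContent h E < c) :
    ∃ V, IsOpen V ∧ E ⊆ V ∧ hausdorffContent h V < c := by
  obtain ⟨t, htE, ht⟩ := hausdorffContent_lt_iff.1 hE
  obtain ⟨ε, hε0, hε⟩ := ENNReal.exists_pos_sum_of_countable (tsub_pos_of_lt ht).ne' ℕ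
  set a : ℕ → ℝ≥0∞ := fun i => ⨆ _ : (t i).Nonempty, ediam (t i) ^ (h : ℝ)
  have hthick : ∀ i, ∃ r : ℝ, 0 < r ∧ (⨆ _ : (thickening r (t i)).Nonempty,
      ediam (thickening r (t i)) ^ (h : ℝ)) ≤ a i + ε i := fun i => by
    rcases (t i).eq_empty_or_nonempty with hi | hi
    · exact ⟨1, one_pos, by simp [hi]⟩
    have ha : ediam (t i) ^ (h : ℝ) = a i := by simp [a, hi]
    have hai : a i ≠ ⊤ := ENNReal.ne_top_of_tsum_ne_top ht.ne_top i
    obtain ⟨r, hr, hrt⟩ := exists_ediam_thickening_rpow_lt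
      (ha.trans_lt (ENNReal.lt_add_right hai (ENNReal.coe_ne_zero.2 (hε0 i).ne')))
    exact ⟨r, hr, iSup_le fun _ => hrt.le⟩
  choose r hr hrt using hthick
  refine ⟨⋃ i, thickening (r i) (t i), isOpen_iUnion fun i => isOpen_thickening,
    htE.trans (iUnion_mono fun i => self_subset_thickening (hr i) _),
    hausdorffContent_lt_iff.2 ⟨_, Subset.rfl, ?_⟩⟩
  calc ∑' i, ⨆ _ : (thickening (r i) (t i)).Nonempty, ediam (thickening (r i) (t i)) ^ (h : ℝ)
      ≤ ∑' i, a i + ∑' i, (ε i : ℝ≥0∞) := (ENNReal.tsum_le_tsum hrt).trans_eq ENNReal.tsum_add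
    _ < c := by rw [add_comm]; exact lt_tsub_iff_right.1 hε

end Content

section NullSets

variable {X : Type*} [EMetricSpace X] {h : ℝ≥0} {E : Set X}

theorem hausdorffContent_eq_zero_iff [MeasurableSpace X] [BorelSpace X] :
    hausdorffContent h E = 0 ↔ μH[h] E = 0 := by
  rw [Measure.hausdorffMeasure_apply]
  refine ⟨fun hE => ?_, fun hE => ?_⟩
  · simp only [ENNReal.iSup_eq_zero]
    refine fun r hr => nonpos_iff_eq_zero.1 (le_of_forall_gt fun ε hε => ?_)
    obtain ⟨t, htE, ht⟩ := hausdorffContent_lt_iff.1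
      (hE.trans_lt (lt_min hε (ENNReal.rpow_pos_of_nonneg hr h.coe_nonneg)))
    have hdiam : ∀ i, ediam (t i) ≤ r := fun i => by
      rcases (t i).eq_empty_or_nonempty with hi | hi
      · simp [hi]
      by_contra! hri
      refine ((ENNReal.le_tsum i).trans_lt (ht.trans_le (min_le_right _ _))).not_ge ?_
      simpa only [hi, iSup_pos] using ENNReal.rpow_le_rpow hri.le h.coe_nonneg
    exact (iInf₂_le_of_le t htE (iInf_le _ hdiam)).trans_lt (ht.trans_le (min_le_left _ _))
  · rw [hausdorffContent, OuterMeasure.boundedBy_apply, ← nonpos_iff_eq_zero, ← hE]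
    exact le_iSup₂_of_le 1 one_pos (iInf₂_mono fun t _ => le_iInf fun _ => le_rfl)

theorem exists_isGδ_superset_dimH_eq (E : Set X) :
    ∃ G, IsGδ G ∧ E ⊆ G ∧ dimH G = dimH E := by
  borelize X
  rcases eq_or_ne (dimH E) ⊤ with htop | htop
  · exact ⟨univ, .univ, subset_univ E, htop ▸ top_unique (htop ▸ dimH_mono (subset_univ E))⟩
  lift dimH E to ℝ≥0 using htop with s hs
  obtain ⟨u, -, hus, hu⟩ := exists_seq_strictAnti_tendsto s
  obtain ⟨ε, -, hε0, hε⟩ := exists_seq_strictAnti_tendsto (0 : ℝ≥0)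
  have hnull : ∀ k, hausdorffContent (u k) E = 0 := fun k => hausdorffContent_eq_zero_iff.2
    (hausdorffMeasure_of_dimH_lt (hs ▸ ENNReal.coe_lt_coe.2 (hus k)))
  choose V hVo hEV hV using fun k m => exists_isOpen_superset_hausdorffContent_lt
    ((hnull k).trans_lt (ENNReal.coe_pos.2 (hε0 m)))
  have hEG : E ⊆ ⋂ k, ⋂ m, V k m := subset_iInter₂ hEV
  refine ⟨⋂ k, ⋂ m, V k m, .iInter fun k => .iInter fun m => (hVo k m).isGδ, hEG,
    le_antisymm ?_ (hs ▸ dimH_mono hEG)⟩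
  refine ge_of_tendsto' (ENNReal.tendsto_coe.2 hu) fun k => dimH_le_of_hausdorffMeasure_ne_top ?_
  have hG : hausdorffContent (u k) (⋂ k, ⋂ m, V k m) = 0 := nonpos_iff_eq_zero.1 <|
    ge_of_tendsto' (ENNReal.tendsto_coe.2 hε) fun m =>
      (measure_mono (iInter₂_subset k m)).trans (hV k m).le
  simp [hausdorffContent_eq_zero_iff.1 hG]

end NullSets

section HausdorffDim

variable {X : Type u} [MetricSpace X] {h : ℝ≥0} {E G : Set X}

theorem hausdorffDim_of_nonempty (hE : E.Nonempty) :
    hausdorffDim E = ((dimH E : ℝ≥0∞) : EReal) := by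
  rw [hausdorffDim, if_neg hE.ne_empty]

theorem neg_one_le_hausdorffDim (E : Set X) : -1 ≤ hausdorffDim E := by
  rw [hausdorffDim]
  split_ifs
  · exact le_rfl
  · exact le_trans (by norm_num) (EReal.coe_ennreal_nonneg _)

theorem dimH_le_of_hausdorffDim_le {t : ℝ≥0} (hE : hausdorffDim E ≤ ((t : ℝ) : EReal)) :
    dimH E ≤ t := by
  rcases E.eq_empty_or_nonempty with rfl | hne
  · simp
  · rw [hausdorffDim_of_nonempty hne] at hE
    exact EReal.coe_ennreal_le_coe_ennreal_iff.1 hE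

theorem hausdorffDim_le_of_finite_diff (hG : G.Nonempty) (hEG : (E \ G).Finite) :
    hausdorffDim E ≤ hausdorffDim G := by
  rcases E.eq_empty_or_nonempty with rfl | hE
  · rw [hausdorffDim, if_pos rfl]
    exact neg_one_le_hausdorffDim G
  rw [hausdorffDim_of_nonempty hE, hausdorffDim_of_nonempty hG,
    EReal.coe_ennreal_le_coe_ennreal_iff]
  calc dimH E ≤ dimH (G ∪ E \ G) := dimH_mono (by simp)
    _ = dimH G := by rw [dimH_union, dimH_finite hEG, max_eq_left zero_le]

/-- An upper bound for `hausdorffDim` on sets of vanishing `h`-dimensional content: for `h = 0` only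
the empty set, of dimension `-1`, is null. -/
noncomputable def nullBound (h : ℝ≥0) : ℝ := if h = 0 then -1 else h

theorem neg_one_le_nullBound (h : ℝ≥0) : -1 ≤ nullBound h := by
  rw [nullBound]
  split_ifs
  · exact le_rfl
  · linarith [h.coe_nonneg]

theorem hausdorffDim_le_nullBound (hE : hausdorffContent h E = 0) :
    hausdorffDim E ≤ (nullBound h : EReal) := by
  borelize X
  rcases E.eq_empty_or_nonempty with rfl | hne
  · rw [hausdorffDim, if_pos rfl]
    exact EReal.coe_le_coe (neg_one_le_nullBound h)
  have hh : h ≠ 0 := by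
    rintro rfl
    exact hne.ne_empty (eq_empty_of_hausdorffContent_zero_lt_one (hE.trans_lt one_pos))
  have hdim : dimH E ≤ h :=
    dimH_le_of_hausdorffMeasure_ne_top (by simp [hausdorffContent_eq_zero_iff.1 hE])
  rw [hausdorffDim_of_nonempty hne, nullBound, if_neg hh]
  exact EReal.coe_ennreal_le_coe_ennreal_iff.2 hdim

theorem le_hausdorffDim_of_hausdorffContent_ne_zero (hE : hausdorffContent h E ≠ 0) :
    ((h : ℝ) : EReal) ≤ hausdorffDim E := by
  borelize X
  have hne : E.Nonempty := nonempty_iff_ne_empty.2 fun h0 => hE (h0 ▸ measure_empty)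
  rw [hausdorffDim_of_nonempty hne]
  exact EReal.coe_ennreal_le_coe_ennreal_iff.2
    (le_dimH_of_hausdorffMeasure_ne_zero (mt hausdorffContent_eq_zero_iff.2 hE))

end HausdorffDim

/-- The set of points at which every function of the tuple `g` takes the value prescribed by `y`:
the fibre over `y` of the map to `ι → ℝ` with coordinates `g`. -/
def jointFiber {X ι : Type*} [TopologicalSpace X] (g : ι → C(X, ℝ)) (y : ι → ℝ) : Set X :=
  {x | ∀ i, g i x = y i}

/-- The common zeros in `A` of generic `n` real functions have vanishing `h`-dimensional content. -/
def GenericallyNull {X : Type*} [PseudoEMetricSpace X] (h : ℝ≥0) (n : ℕ) (A : Set X) : Prop :=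
  ∀ᶠ g : Fin n → C(X, ℝ) in residual _, hausdorffContent h (A ∩ jointFiber g 0) = 0

section GenericallyNull

variable {X : Type*} [PseudoEMetricSpace X] {h : ℝ≥0} {n : ℕ} {A B : Set X}

theorem GenericallyNull.mono (hB : GenericallyNull h n B) (hAB : A ⊆ B) : GenericallyNull h n A :=
  Eventually.mono hB fun _ hg => measure_mono_null (inter_subset_inter_left _ hAB) hg

variable [CompactSpace X]

theorem isOpen_setOf_hausdorffContent_lt {ι : Type*} (hA : IsClosed A) (c : ℝ≥0∞) :
    IsOpen {g : ι → C(X, ℝ) | hausdorffContent h (A ∩ jointFiber g 0) < c} := by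
  refine isOpen_iff_mem_nhds.2 fun g hg => ?_
  obtain ⟨V, hVo, hgV, hV⟩ := exists_isOpen_superset_hausdorffContent_lt hg
  have hclosed : IsClosed {p : (ι → C(X, ℝ)) × X | p.2 ∈ A \ V ∩ jointFiber p.1 0} := by
    have hinter : {p : (ι → C(X, ℝ)) × X | p.2 ∈ A \ V ∩ jointFiber p.1 0} =
        Prod.snd ⁻¹' (A \ V) ∩ ⋂ i, {p : (ι → C(X, ℝ)) × X | p.1 i p.2 = 0} := by
      ext p
      simp [jointFiber]
    rw [hinter]
    exact ((hA.sdiff hVo).preimage continuous_snd).inter (isClosed_iInter fun i => isClosed_eq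
      (((continuous_apply i).comp continuous_fst).eval continuous_snd) continuous_const)
  -- The tuples with a common zero in `A \ V` form a closed set, by compactness of `X`.
  refine mem_of_superset ((isClosedMap_fst_of_compactSpace _ hclosed).isOpen_compl.mem_nhds ?_)
    fun g' hg' => (measure_mono fun x hx => ?_).trans_lt hV
  · rintro ⟨⟨_, x⟩, ⟨hx, hxg⟩, rfl⟩
    exact hx.2 (hgV ⟨hx.1, hxg⟩)
  · by_contra hxV
    exact hg' ⟨(g', x), ⟨⟨hx.1, hxV⟩, hx.2⟩, rfl⟩

theorem genericallyNull_iff_dense (hA : IsClosed A) :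
    GenericallyNull h n A ↔
      ∀ ε > 0, Dense {g : Fin n → C(X, ℝ) | hausdorffContent h (A ∩ jointFiber g 0) < ε} := by
  refine ⟨fun hnull ε hε => (dense_of_mem_residual hnull).mono fun g hg => ?_, fun hdense => ?_⟩
  · exact (le_of_eq hg).trans_lt hε
  obtain ⟨u, -, hu0, hu⟩ := exists_seq_strictAnti_tendsto (0 : ℝ≥0)
  have hgeneric : ∀ k, ∀ᶠ g : Fin n → C(X, ℝ) in residual _,
      hausdorffContent h (A ∩ jointFiber g 0) < u k := fun k =>
    residual_of_dense_open (isOpen_setOf_hausdorffContent_lt hA _)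
      (hdense _ (ENNReal.coe_pos.2 (hu0 k)))
  filter_upwards [eventually_countable_forall.2 hgeneric] with g hg
  exact nonpos_iff_eq_zero.1 (ge_of_tendsto' (ENNReal.tendsto_coe.2 hu) fun k => (hg k).le)

theorem GenericallyNull.subtype (hA : IsClosed A) (hnull : GenericallyNull h n A) :
    GenericallyNull h n (univ : Set A) := by
  have : CompactSpace A := isCompact_iff_compactSpace.1 hA.isCompact
  rw [genericallyNull_iff_dense hA] at hnull
  refine (genericallyNull_iff_dense isClosed_univ).2 fun ε hε => ?_
  let restr : (Fin n → C(X, ℝ)) → (Fin n → C(A, ℝ)) := fun g i => (g i).restrict A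
  have hcont : Continuous restr := continuous_pi fun i =>
    (ContinuousMap.continuous_restrict A).comp (continuous_apply i)
  have hsurj : Function.Surjective restr := fun g => by
    choose g' hg' using fun i => ContinuousMap.exists_restrict_eq hA (g i)
    exact ⟨g', funext hg'⟩
  refine (hsurj.denseRange.dense_image hcont (hnull ε hε)).mono ?_
  rintro _ ⟨g, hg, rfl⟩
  have himage : (↑) '' (univ ∩ jointFiber (restr g) 0) = A ∩ jointFiber g 0 := by
    ext x
    simp [jointFiber, restr, and_comm]
  rw [mem_ofPred_eq, ← hausdorffContent_image_of_isometry isometry_subtype_coe, himage]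
  exact hg

theorem GenericallyNull.eventually_slice (hA : GenericallyNull h (n + 1) A) :
    ∀ᶠ g : C(X, ℝ) in residual _, GenericallyNull h n (A ∩ g ⁻¹' {0}) := by
  let e := (Fin.consEquivL ℝ fun _ : Fin (n + 1) => C(X, ℝ)).toHomeomorph
  have hcons : ∀ᶠ p : C(X, ℝ) × (Fin n → C(X, ℝ)) in residual _,
      hausdorffContent h (A ∩ jointFiber (e p) 0) = 0 := by
    rw [GenericallyNull, ← e.residual_map_eq] at hA
    exact hA
  filter_upwards [eventually_residual_curry hcons] with g hg
  refine Eventually.mono hg fun g' hg' => ?_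
  rwa [inter_assoc, show g ⁻¹' {0} ∩ jointFiber g' 0 = jointFiber (e (g, g')) 0 by
    ext x; simp [jointFiber, e, Fin.forall_fin_succ]]

theorem genericallyNull_univ_of_forall_nhds
    (hX : ∀ x : X, ∃ N ∈ 𝓝 x, GenericallyNull h n N) : GenericallyNull h n (univ : Set X) := by
  choose N hN hnull using hX
  obtain ⟨s, -, hs⟩ := isCompact_univ.elim_nhds_subcover N fun x _ => hN x
  filter_upwards [(eventually_countable_ball s.countable_toSet).2 fun x _ => hnull x] with g hg
  refine measure_mono_null ?_ ((measure_biUnion_null_iff s.countable_toSet).2 hg)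
  rw [← iUnion₂_inter]
  exact inter_subset_inter_left _ hs

end GenericallyNull

/-- Every tuple sufficiently close to `g` has common zeros in `A` whose `h`-dimensional content is
bounded below. The failure of `GenericallyNull` produces such tuples. -/
def HasStablyLargeZeros {X ι : Type*} [PseudoEMetricSpace X] (h : ℝ≥0) (A : Set X)
    (g : ι → C(X, ℝ)) : Prop :=
  ∃ ε > 0, ∀ᶠ g' in 𝓝 g, ε ≤ hausdorffContent h (A ∩ jointFiber g' 0)

section StablyLargeZeros

variable {X ι : Type*} [PseudoEMetricSpace X] {h : ℝ≥0} {A B : Set X} {g f : ι → C(X, ℝ)}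

theorem HasStablyLargeZeros.mono (hg : HasStablyLargeZeros h A g) (hAB : A ⊆ B) :
    HasStablyLargeZeros h B g :=
  let ⟨ε, hε, hgε⟩ := hg
  ⟨ε, hε, hgε.mono fun _ hle => hle.trans (measure_mono (inter_subset_inter_left _ hAB))⟩

theorem HasStablyLargeZeros.congr (hg : HasStablyLargeZeros h A g)
    (hfg : ∀ i, ∀ x ∈ A, f i x = g i x) : HasStablyLargeZeros h A f := by
  obtain ⟨ε, hε, hgε⟩ := hg
  have htranslate : Tendsto (fun f' => f' - f + g) (𝓝 f) (𝓝 g) :=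
    (by fun_prop : Continuous fun f' => f' - f + g).tendsto' _ _ (by simp)
  refine ⟨ε, hε, (htranslate.eventually hgε).mono fun f' hf' => hf'.trans_eq ?_⟩
  congr 1
  ext x
  simp +contextual [jointFiber, hfg]

theorem HasStablyLargeZeros.smul {k : ℝ} (hk : k ≠ 0) (hg : HasStablyLargeZeros h A g) :
    HasStablyLargeZeros h A (k • g) := by
  obtain ⟨ε, hε, hgε⟩ := hg
  have hscale : Tendsto (fun g' : ι → C(X, ℝ) => k⁻¹ • g') (𝓝 (k • g)) (𝓝 g) :=
    (continuous_const_smul k⁻¹).tendsto' _ _ (inv_smul_smul₀ hk g)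
  refine ⟨ε, hε, (hscale.eventually hgε).mono fun g' hg' => hg'.trans_eq ?_⟩
  congr 1
  ext x
  simp [jointFiber, hk]

theorem HasStablyLargeZeros.eventually_jointFiber {c : ι → ℝ}
    (hf : HasStablyLargeZeros h univ (f - fun i => ContinuousMap.const X (c i))) :
    ∃ ε > 0, ∀ᶠ y in 𝓝 c, ε ≤ hausdorffContent h (jointFiber f y) := by
  obtain ⟨ε, hε, hfε⟩ := hf
  have htranslate : Continuous fun y : ι → ℝ => f - fun i => ContinuousMap.const X (y i) := by
    fun_prop
  refine ⟨ε, hε, (htranslate.continuousAt.eventually hfε).mono fun y hy => hy.trans_eq ?_⟩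
  congr 1
  ext x
  simp [jointFiber, sub_eq_zero]

theorem isOpen_setOf_hasStablyLargeZeros :
    IsOpen {g : ι → C(X, ℝ) | HasStablyLargeZeros h A g} := by
  refine isOpen_iff_eventually.2 fun g ⟨ε, hε, hgε⟩ => ?_
  filter_upwards [hgε.eventually_nhds] with g' hg'
  exact ⟨ε, hε, hg'⟩

end StablyLargeZeros

theorem exists_continuousMap_truncate {X : Type*} [TopologicalSpace X] [CompactSpace X] {δ : ℝ}
    (hδ : 0 ≤ δ) (u v : C(X, ℝ)) :
    ∃ w : C(X, ℝ), ‖w - v‖ ≤ δ ∧ ∀ x, |u x - v x| ≤ δ → w x = u x := by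
  refine ⟨⟨fun x => v x + max (-δ) (min δ (u x - v x)), by fun_prop⟩, ?_, fun x hx => ?_⟩
  · refine (ContinuousMap.norm_le _ hδ).2 fun x => ?_
    simp only [ContinuousMap.sub_apply, ContinuousMap.coe_mk, Real.norm_eq_abs, add_sub_cancel_left]
    exact abs_le.2 ⟨le_max_left _ _, max_le (by linarith) (min_le_left _ _)⟩
  · obtain ⟨hle, hge⟩ := abs_le.1 hx
    simp [min_eq_right hge, max_eq_right hle]

section LargeFibers

variable {X : Type*} [PseudoEMetricSpace X] [CompactSpace X] {h : ℝ≥0} {n : ℕ} {A : Set X}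

theorem exists_hasStablyLargeZeros (hA : IsClosed A) (hnull : ¬ GenericallyNull h n A) :
    ∃ g : Fin n → C(X, ℝ), HasStablyLargeZeros h A g := by
  simp only [genericallyNull_iff_dense hA, not_forall, Dense] at hnull
  obtain ⟨ε, hε, g, hg⟩ := hnull
  refine ⟨g, ε, hε, ?_⟩
  filter_upwards [isClosed_closure.isOpen_compl.mem_nhds hg] with g' hg'
  exact not_lt.1 fun hlt => hg' (subset_closure hlt)

theorem exists_hasStablyLargeZeros_norm_lt (hA : IsClosed A) (hnull : ¬ GenericallyNull h n A)
    {δ : ℝ} (hδ : 0 < δ) : ∃ g : Fin n → C(X, ℝ), ‖g‖ < δ ∧ HasStablyLargeZeros h A g := by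
  obtain ⟨g, hg⟩ := exists_hasStablyLargeZeros hA hnull
  have hsmall : ∀ᶠ k : ℝ in 𝓝 0, ‖k • g‖ < δ :=
    (by fun_prop : Continuous fun k : ℝ => ‖k • g‖).continuousAt.eventually_lt_const (by simpa)
  obtain ⟨k, hkδ, hk⟩ :=
    ((hsmall.filter_mono (nhdsWithin_le_nhds (s := {0}ᶜ))).and self_mem_nhdsWithin).exists
  exact ⟨k • g, hkδ, hg.smul hk⟩

theorem dense_setOf_exists_hasStablyLargeZeros_sub_const
    (hX : ¬ GenericallyNull h n (univ : Set X)) :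
    Dense {f : Fin n → C(X, ℝ) | ∃ c : Fin n → ℝ,
      HasStablyLargeZeros h univ (f - fun i => ContinuousMap.const X (c i))} := by
  obtain ⟨x₀, hx₀⟩ : ∃ x₀ : X, ∀ N ∈ 𝓝 x₀, ¬ GenericallyNull h n N := by
    by_contra! hlocal
    exact hX (genericallyNull_univ_of_forall_nhds hlocal)
  refine Metric.dense_iff.2 fun f₀ η hη => ?_
  have hf₀ : Continuous fun x i => f₀ i x := by fun_prop
  let c : Fin n → ℝ := fun i => f₀ i x₀
  let N : Set X := (fun x i => f₀ i x) ⁻¹' closedBall c (η / 4)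
  have hN : ∀ x ∈ N, ∀ i, |f₀ i x - c i| ≤ η / 4 := fun x hx i =>
    (dist_le_pi_dist _ _ i).trans hx
  obtain ⟨g, hgη, hg⟩ := exists_hasStablyLargeZeros_norm_lt (isClosed_closedBall.preimage hf₀)
    (hx₀ N (hf₀.continuousAt (closedBall_mem_nhds c (by positivity)))) (δ := η / 4) (by positivity)
  -- On `N` both `f₀` and `c + g` are close to `c`, so `f₀` can be perturbed to agree with `c + g`.
  choose f hff₀ hf using fun i => exists_continuousMap_truncate (δ := η / 2) (by positivity)
    (ContinuousMap.const X (c i) + g i) (f₀ i)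
  have hfN : ∀ i, ∀ x ∈ N, f i x - c i = g i x := fun i x hx => by
    have hgx : |g i x| ≤ η / 4 :=
      ((g i).norm_coe_le_norm x).trans ((norm_le_pi_norm g i).trans hgη.le)
    have hclose : |c i + g i x - f₀ i x| ≤ η / 2 := by
      rw [abs_le] at hgx ⊢
      have := abs_le.1 (hN x hx i)
      constructor <;> linarith
    rw [hf i x hclose]
    simp
  refine ⟨f, ?_, c, (hg.congr hfN).mono (subset_univ N)⟩
  rw [mem_ball, dist_eq_norm]
  exact ((pi_norm_le_iff_of_nonneg (by positivity)).2 hff₀).trans_lt (by linarith)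

theorem eventually_residual_le_hausdorffContent_jointFiber
    (hX : ¬ GenericallyNull h n (univ : Set X)) :
    ∀ᶠ f : Fin n → C(X, ℝ) in residual _, ∃ c, ∃ ε > 0, ∀ᶠ y in 𝓝 c,
      ε ≤ hausdorffContent h (jointFiber f y) := by
  refine mem_of_superset (residual_of_dense_open ?_
    (dense_setOf_exists_hasStablyLargeZeros_sub_const hX)) fun f ⟨c, hc⟩ =>
      ⟨c, hc.eventually_jointFiber⟩
  simp only [ofPred_exists]
  exact isOpen_iUnion fun c => isOpen_setOf_hasStablyLargeZeros.preimage (by fun_prop)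

end LargeFibers

theorem isTopologicalBasis_setOf_lt_zero_of_dense {X : Type*} [TopologicalSpace X] [CompactSpace X]
    [CompletelyRegularSpace X] {S : Set C(X, ℝ)} (hS : Dense S) :
    IsTopologicalBasis ((fun g : C(X, ℝ) => {x | g x < 0}) '' S) := by
  refine isTopologicalBasis_of_isOpen_of_nhds ?_ fun x U hxU hU => ?_
  · rintro _ ⟨g, -, rfl⟩
    exact isOpen_lt g.continuous continuous_const
  obtain ⟨f, hf, hfx, hfU⟩ := CompletelyRegularSpace.completely_regular x Uᶜ hU.isClosed_compl
    (not_not.2 hxU)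
  let f' : C(X, ℝ) := ⟨fun y => f y - 1 / 2, by fun_prop⟩
  obtain ⟨g, hgS, hgf⟩ := hS.exists_dist_lt f' (show (0 : ℝ) < 1 / 2 by norm_num)
  have hclose : ∀ y, |(f y : ℝ) - 1 / 2 - g y| < 1 / 2 := fun y =>
    (ContinuousMap.dist_apply_le_dist (f := f') (g := g) y).trans_lt hgf
  refine ⟨_, mem_image_of_mem _ hgS, ?_, fun y (hy : g y < 0) => ?_⟩
  · have := (abs_lt.1 (hclose x)).1
    rw [hfx] at this
    simp only [mem_ofPred_eq]
    norm_num at this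
    exact this
  · by_contra hyU
    have := (abs_lt.1 (hclose y)).2
    rw [hfU hyU] at this
    norm_num at this
    linarith

theorem indTopHausdorffDim_le_of_genericallyNull {h : ℝ≥0} (n : ℕ) (X : Type u) [MetricSpace X]
    [CompactSpace X] (hX : GenericallyNull h n (univ : Set X)) :
    indTopHausdorffDim n X ≤ ((nullBound h + n : ℝ) : EReal) := by
  induction n generalizing X with
  | zero =>
    obtain ⟨g, hg⟩ := (dense_of_mem_residual hX).nonempty
    have hfiber : jointFiber g 0 = univ := eq_univ_of_forall fun x i => i.elim0
    rw [mem_ofPred_eq, hfiber, univ_inter] at hg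
    simpa [indTopHausdorffDim] using hausdorffDim_le_nullBound hg
  | succ n ih =>
    rw [indTopHausdorffDim]
    split_ifs
    · refine EReal.coe_le_coe ((neg_one_le_nullBound h).trans ?_)
      linarith [(n + 1).cast_nonneg (α := ℝ)]
    refine sInf_le ⟨_, isTopologicalBasis_setOf_lt_zero_of_dense
      (dense_of_mem_residual hX.eventually_slice), ?_⟩
    rintro _ ⟨g, hg, rfl⟩
    have hfrontier : frontier {x | g x < 0} ⊆ univ ∩ g ⁻¹' {0} := fun x hx =>
      ⟨mem_univ x, frontier_lt_subset_eq g.continuous continuous_const hx⟩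
    have : CompactSpace (frontier {x | g x < 0}) :=
      isCompact_iff_compactSpace.1 isClosed_frontier.isCompact
    refine (ih _ ((GenericallyNull.mono hg hfrontier).subtype isClosed_frontier)).trans_eq ?_
    rw [← EReal.coe_one, ← EReal.coe_sub]
    congr 1
    push_cast
    ring

theorem hasSmallInductiveDimensionLT_of_indTopHausdorffDim_lt (n : ℕ) (X : Type u) [MetricSpace X]
    (hX : indTopHausdorffDim n X < (n : EReal)) : HasSmallInductiveDimensionLT X n := by
  induction n generalizing X with
  | zero =>
    rw [hasSmallInductiveDimensionLT_zero_iff]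
    by_contra! hne
    rw [indTopHausdorffDim, hausdorffDim_of_nonempty univ_nonempty, Nat.cast_zero] at hX
    exact hX.not_ge (EReal.coe_ennreal_nonneg _)
  | succ n ih =>
    rw [indTopHausdorffDim] at hX
    split_ifs at hX
    · infer_instance
    obtain ⟨d, ⟨B, hB, hBd⟩, hd⟩ := sInf_lt_iff.1 hX
    refine .succ n B hB fun U hU => ih _ ((hBd U hU).trans_lt ?_)
    refine EReal.sub_lt_of_lt_add' ?_
    rwa [add_comm, ← Nat.cast_one, ← Nat.cast_add]

theorem natCast_le_indTopHausdorffDim {n : ℕ} {X : Type u} [MetricSpace X]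
    (hX : (n : WithBot ℕ∞) ≤ smallInductiveDimension X) : (n : EReal) ≤ indTopHausdorffDim n X := by
  by_contra! hlt
  exact hX.not_gt (smallInductiveDimension_lt_iff.2
    (hasSmallInductiveDimensionLT_of_indTopHausdorffDim_lt n X hlt))

theorem exists_nullBound_add_lt {n : ℕ} {D : EReal} (hD : (n : EReal) ≤ D) {d : ℝ}
    (hd : (d : EReal) < D) :
    ∃ q : ℚ≥0, ((nullBound q + n : ℝ) : EReal) < D ∧ d - n ≤ (q : ℝ≥0) := by
  rcases lt_or_ge d n with hdn | hdn
  · refine ⟨0, lt_of_lt_of_le ?_ hD, by simpa using hdn.le⟩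
    rw [← EReal.coe_natCast, EReal.coe_lt_coe_iff]
    simp [nullBound]
  obtain ⟨q, hdq, hqD⟩ := EReal.lt_iff_exists_rat_btwn.1 hd
  have hnq : (n : ℝ) < q := hdn.trans_lt (EReal.coe_lt_coe_iff.1 hdq)
  have hq : (n : ℚ) < q := by exact_mod_cast hnq
  have hcoe : (((q - n).toNNRat : ℝ≥0) : ℝ) = q - n := by
    have hcast := congrArg (Rat.cast : ℚ → ℝ) (Rat.coe_toNNRat _ (sub_pos.2 hq).le)
    push_cast at hcast ⊢
    exact hcast
  refine ⟨(q - n).toNNRat, ?_, hcoe ▸ ?_⟩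
  · rw [nullBound, if_neg (by simpa using hq), hcoe, sub_add_cancel]
    exact hqD
  · linarith [EReal.coe_lt_coe_iff.1 hdq]

theorem eventually_residual_le_hausdorffDim_jointFiber {X : Type u} [MetricSpace X] [CompactSpace X]
    {n : ℕ} (hX : (n : EReal) ≤ indTopHausdorffDim n X) :
    ∀ᶠ g : Fin n → C(X, ℝ) in residual _, ∀ d : ℝ, (d : EReal) < indTopHausdorffDim n X →
      ∃ c, ∀ᶠ y in 𝓝 c, (d : EReal) - (n : EReal) ≤ hausdorffDim (jointFiber g y) := by
  have hgeneric : ∀ q : ℚ≥0, ((nullBound q + n : ℝ) : EReal) < indTopHausdorffDim n X →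
      ∀ᶠ g : Fin n → C(X, ℝ) in residual _, ∃ c, ∀ᶠ y in 𝓝 c,
        (((q : ℝ≥0) : ℝ) : EReal) ≤ hausdorffDim (jointFiber g y) := fun q hq => by
    have hnot : ¬ GenericallyNull (q : ℝ≥0) n (univ : Set X) := fun hnull =>
      (indTopHausdorffDim_le_of_genericallyNull n X hnull).not_gt hq
    filter_upwards [eventually_residual_le_hausdorffContent_jointFiber hnot] with g ⟨c, ε, hε, hg⟩
    exact ⟨c, hg.mono fun y hy =>
      le_hausdorffDim_of_hausdorffContent_ne_zero (hε.trans_le hy).ne'⟩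
  simp only [← eventually_imp_distrib_left] at hgeneric
  filter_upwards [eventually_countable_forall.2 hgeneric] with g hg d hd
  obtain ⟨q, hqX, hdq⟩ := exists_nullBound_add_lt hX hd
  obtain ⟨c, hc⟩ := hg q hqX
  refine ⟨c, hc.mono fun y hy => le_trans ?_ hy⟩
  rw [← EReal.coe_natCast, ← EReal.coe_sub]
  exact EReal.coe_le_coe hdq

section FinelySplit

variable {X : Type*} [PseudoMetricSpace X] {ε ε' : ℝ} {C D : Set X}

/-- A closed set with a locally constant labelling each of whose classes has diameter at most `ε`:
a closed set of dimension zero at scale `ε`. -/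
def IsFinelySplit (ε : ℝ) (C : Set X) : Prop :=
  IsClosed C ∧ ∃ p : X → ℕ, ContinuousOn p C ∧ ∀ x ∈ C, ∀ y ∈ C, p x = p y → dist x y ≤ ε

theorem isFinelySplit_of_labelling {ι : Type*} [Countable ι] [TopologicalSpace ι]
    [DiscreteTopology ι] (hC : IsClosed C) {p : X → ι} (hp : ContinuousOn p C)
    (hdist : ∀ x ∈ C, ∀ y ∈ C, p x = p y → dist x y ≤ ε) : IsFinelySplit ε C := by
  obtain ⟨e, he⟩ := exists_injective_nat ι
  exact ⟨hC, e ∘ p, continuous_of_discreteTopology.comp_continuousOn hp,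
    fun x hx y hy hxy => hdist x hx y hy (he hxy)⟩

theorem IsFinelySplit.mono (hC : IsFinelySplit ε C) (hε : ε ≤ ε') : IsFinelySplit ε' C :=
  let ⟨hcl, p, hp, hdist⟩ := hC
  ⟨hcl, p, hp, fun x hx y hy hxy => (hdist x hx y hy hxy).trans hε⟩

theorem IsFinelySplit.subset (hC : IsFinelySplit ε C) (hD : IsClosed D) (hDC : D ⊆ C) :
    IsFinelySplit ε D :=
  let ⟨_, p, hp, hdist⟩ := hC
  ⟨hD, p, hp.mono hDC, fun x hx y hy hxy => hdist x (hDC hx) y (hDC hy) hxy⟩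

theorem IsFinelySplit.union_of_disjoint (hC : IsFinelySplit ε C) (hD : IsFinelySplit ε D)
    (hCD : Disjoint C D) : IsFinelySplit ε (C ∪ D) := by
  classical
  obtain ⟨hCcl, p, hp, hpdist⟩ := hC
  obtain ⟨hDcl, q, hq, hqdist⟩ := hD
  have hDC : ∀ x ∈ D, x ∉ C := fun x hx hx' => disjoint_left.1 hCD hx' hx
  let label : X → ℕ ⊕ ℕ := fun x => if x ∈ C then .inl (p x) else .inr (q x)
  have hlabel : ContinuousOn label (C ∪ D) := by
    refine ContinuousOn.union_of_isClosed ?_ ?_ hCcl hDcl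
    · exact (continuous_inl.comp_continuousOn hp).congr fun x hx => if_pos hx
    · exact (continuous_inr.comp_continuousOn hq).congr fun x hx => if_neg (hDC x hx)
  refine isFinelySplit_of_labelling (hCcl.union hDcl) hlabel ?_
  rintro x (hx | hx) y (hy | hy) hxy
  · simp only [label, hx, hy, if_true, Sum.inl.injEq] at hxy
    exact hpdist x hx y hy hxy
  · simp [label, hx, hDC y hy] at hxy
  · simp [label, hy, hDC x hx] at hxy
  · simp only [label, hDC x hx, hDC y hy, if_false, Sum.inr.injEq] at hxy
    exact hqdist x hx y hy hxy

theorem isFinelySplit_of_disjoint_frontier {ι : Type*} [Finite ι] {U : ι → Set X}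
    (hC : IsClosed C) (hCU : C ⊆ ⋃ i, U i) (hdist : ∀ i, ∀ x ∈ U i, ∀ y ∈ U i, dist x y ≤ ε)
    (hfrontier : ∀ i, Disjoint C (frontier (U i))) : IsFinelySplit ε C := by
  have hlabel : ContinuousOn (fun x i => (U i).boolIndicator x) C := by
    refine continuousOn_pi.2 fun i => (continuousOn_boolIndicator_iff_isClopen _ _).2 ?_
    refine isClopen_iff_frontier_eq_empty.2 (eq_empty_of_forall_notMem fun x hx => ?_)
    exact disjoint_left.1 (hfrontier i) x.2 (continuous_subtype_val.frontier_preimage_subset _ hx)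
  refine isFinelySplit_of_labelling hC hlabel fun x hx y _ hxy => ?_
  obtain ⟨i, hi⟩ := mem_iUnion.1 (hCU hx)
  refine hdist i x hi y ((mem_iff_boolIndicator _ _).2 ?_)
  rw [← congrFun hxy i]
  exact (mem_iff_boolIndicator _ _).1 hi

theorem IsFinelySplit.image_val {A : Set X} (hA : IsClosed A) {C : Set A}
    (hC : IsFinelySplit ε C) : IsFinelySplit ε ((↑) '' C : Set X) := by
  obtain ⟨hcl, p, hp, hdist⟩ := hC
  have hextend : ∀ x : A, Function.extend Subtype.val p 0 x = p x :=
    Subtype.val_injective.extend_apply p 0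
  refine ⟨hA.isClosedMap_subtype_val _ hcl, Function.extend Subtype.val p 0, ?_, ?_⟩
  · refine (IsInducing.subtypeVal (t := A)).continuousOn_image_iff.2 ?_
    exact hp.congr fun x _ => hextend x
  · rintro _ ⟨x, hx, rfl⟩ _ ⟨y, hy, rfl⟩ hxy
    exact hdist x hx y hy ((hextend x).symm.trans (hxy.trans (hextend y)))

theorem exists_pos_forall_dist_lt_imp_eq {p : X → ℕ} (hC : IsCompact C) (hp : ContinuousOn p C) :
    ∃ δ > 0, ∀ x ∈ C, ∀ y ∈ C, dist x y < δ → p x = p y := by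
  obtain ⟨δ, hδ, hpδ⟩ := Metric.uniformContinuousOn_iff.1
    (hC.uniformContinuousOn_of_continuous hp) 1 one_pos
  refine ⟨δ, hδ, fun x hx y hy hxy => ?_⟩
  by_contra hne
  exact (hpδ x hx y hy hxy).not_ge (Nat.pairwise_one_le_dist hne)

variable [CompactSpace X]

theorem IsFinelySplit.exists_cthickening (hC : IsFinelySplit ε C) (hε : ε < ε') :
    ∃ r > 0, IsFinelySplit ε' (cthickening r C) := by
  obtain ⟨hcl, p, hp, hdist⟩ := hC
  obtain ⟨δ, hδ, hpδ⟩ := exists_pos_forall_dist_lt_imp_eq hcl.isCompact hp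
  obtain ⟨r, hr, hrδε⟩ := exists_between (lt_min (show 0 < δ / 4 by positivity)
    (show 0 < (ε' - ε) / 2 by linarith))
  obtain ⟨hrδ, hrε⟩ := lt_min_iff.1 hrδε
  have hnear : ∀ x ∈ cthickening r C, ∃ c ∈ C, dist x c ≤ r := fun x hx => by
    rw [hcl.isCompact.cthickening_eq_biUnion_closedBall hr.le] at hx
    simpa using hx
  choose! c hcC hc using hnear
  refine ⟨r, hr, isClosed_cthickening, p ∘ c, fun x hx => ?_, fun x hx y hy hxy => ?_⟩
  · refine tendsto_const_nhds.congr' ?_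
    filter_upwards [self_mem_nhdsWithin, mem_nhdsWithin_of_mem_nhds (ball_mem_nhds x hr)]
      with y hy hyx
    refine hpδ _ (hcC x hx) _ (hcC y hy) ?_
    linarith [dist_triangle4 (c x) x y (c y), dist_comm (c x) x, hc x hx, mem_ball'.1 hyx, hc y hy]
  · linarith [dist_triangle4 x (c x) (c y) y, hc x hx, hc y hy, dist_comm (c y) y,
      hdist _ (hcC x hx) _ (hcC y hy) hxy]

theorem IsFinelySplit.exists_union (hC : IsFinelySplit ε C) (hε : ε < ε') (hε' : 0 < ε') :
    ∃ δ > 0, ∀ D : Set X, IsFinelySplit δ D → IsFinelySplit ε' (C ∪ D) := by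
  obtain ⟨r, hr, hrC⟩ := hC.exists_cthickening hε
  refine ⟨min r ε', lt_min hr hε', fun D hDsplit => ?_⟩
  have ⟨hD, q, hq, hqdist⟩ := hDsplit
  -- The classes of `D` that meet `C` are absorbed by a thickening of `C`.
  let S : Set ℕ := q '' (C ∩ D)
  have hclosed : ∀ T : Set ℕ, IsClosed (D ∩ q ⁻¹' T) := fun T =>
    hq.preimage_isClosed_of_isClosed hD (isClosed_discrete T)
  have habsorbed : IsFinelySplit ε' (C ∪ D ∩ q ⁻¹' S) := by
    refine hrC.subset (hC.1.union (hclosed S)) (union_subset (self_subset_cthickening C) ?_)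
    rintro x ⟨hxD, c, hc, hcx⟩
    exact mem_cthickening_of_dist_le x c r C hc.1
      ((hqdist x hxD c hc.2 hcx.symm).trans (min_le_left _ _))
  have hrest : IsFinelySplit ε' (D ∩ q ⁻¹' Sᶜ) :=
    (hDsplit.mono (min_le_right _ _)).subset (hclosed _) inter_subset_left
  have hdisjoint : Disjoint (C ∪ D ∩ q ⁻¹' S) (D ∩ q ⁻¹' Sᶜ) := by
    refine disjoint_left.2 ?_
    rintro x (hxC | hxS) ⟨hxD, hxS'⟩
    · exact hxS' ⟨x, ⟨hxC, hxD⟩, rfl⟩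
    · exact hxS' hxS.2
  have hunion := habsorbed.union_of_disjoint hrest hdisjoint
  rwa [union_assoc, ← inter_union_distrib_left, preimage_compl, union_compl_self, inter_univ]
    at hunion

end FinelySplit

section FineCovers

variable {X : Type*} [PseudoMetricSpace X] {n : ℕ} {E F : Set X}

/-- At every scale, `F` is covered by `n` finely split closed sets: this expresses that the
covering dimension of `F` is less than `n`. -/
def HasFineCovers (n : ℕ) (F : Set X) : Prop :=
  ∀ ε > 0, ∃ C : Fin n → Set X, (∀ i, IsFinelySplit ε (C i)) ∧ F ⊆ ⋃ i, C i

theorem hasFineCovers_empty : HasFineCovers n (∅ : Set X) := fun _ _ =>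
  ⟨fun _ => ∅, fun _ => ⟨isClosed_empty, 0, continuousOn_empty _, by simp⟩, empty_subset _⟩

theorem HasFineCovers.image_val {A : Set X} (hA : IsClosed A) {F : Set A}
    (hF : HasFineCovers n F) : HasFineCovers n ((↑) '' F : Set X) := fun ε hε =>
  let ⟨C, hC, hFC⟩ := hF ε hε
  ⟨fun i => (↑) '' C i, fun i => (hC i).image_val hA, image_iUnion ▸ image_mono hFC⟩

variable [CompactSpace X]

theorem HasFineCovers.union (hE : HasFineCovers n E) (hF : HasFineCovers n F) :
    HasFineCovers n (E ∪ F) := fun ε hε => by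
  obtain ⟨C, hC, hEC⟩ := hE (ε / 2) (by positivity)
  choose δ hδ hδC using fun i => (hC i).exists_union (half_lt_self hε) hε
  obtain ⟨η, hη, hηδ⟩ := Pi.exists_forall_pos_add_lt hδ
  obtain ⟨D, hD, hFD⟩ := hF η hη
  refine ⟨fun i => C i ∪ D i, fun i => hδC i _ ((hD i).mono ?_), ?_⟩
  · linarith [hηδ i]
  · rw [iUnion_union_distrib]
    exact union_subset_union hEC hFD

theorem HasFineCovers.biUnion {ι : Type*} (s : Finset ι) {F : ι → Set X}
    (hF : ∀ i ∈ s, HasFineCovers n (F i)) : HasFineCovers n (⋃ i ∈ s, F i) := by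
  classical
  induction s using Finset.induction_on with
  | empty => simpa using hasFineCovers_empty
  | insert i s _ ih =>
    rw [Finset.set_biUnion_insert]
    exact (hF i (Finset.mem_insert_self i s)).union
      (ih fun j hj => hF j (Finset.mem_insert_of_mem hj))

theorem HasFineCovers.succ_of_frontiers {B : Set (Set X)} (hB : IsTopologicalBasis B)
    (hF : IsClosed F) (hBF : ∀ U ∈ B, HasFineCovers n (F ∩ frontier U)) :
    HasFineCovers (n + 1) F := fun ε hε => by
  have hsmall : ∀ x : X, ∃ U ∈ B, x ∈ U ∧ U ⊆ ball x (ε / 2) := fun x =>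
    hB.exists_subset_of_mem_open (mem_ball_self (by positivity)) isOpen_ball
  choose U hUB hxU hUball using hsmall
  obtain ⟨s, hs⟩ := isCompact_univ.elim_finite_subcover U (fun x => hB.isOpen (hUB x))
    fun x _ => mem_iUnion.2 ⟨x, hxU x⟩
  obtain ⟨C, hC, hFC⟩ := HasFineCovers.biUnion s (fun x _ => hBF _ (hUB x)) (ε / 2) (half_pos hε)
  choose r hr hrC using fun i => (hC i).exists_cthickening (half_lt_self hε)
  have hremainder : IsFinelySplit ε (F \ ⋃ i, thickening (r i) (C i)) := by
    refine isFinelySplit_of_disjoint_frontier (U := fun x : s => U x)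
      (hF.sdiff (isOpen_iUnion fun i => isOpen_thickening)) (fun x _ => ?_)
      (fun x y hy z hz => ?_) fun x => disjoint_left.2 fun y hy hyU => hy.2 ?_
    · simpa using hs (mem_univ x)
    · linarith [dist_triangle_right y z x, mem_ball.1 (hUball x hy), mem_ball.1 (hUball x hz)]
    · obtain ⟨i, hi⟩ := mem_iUnion.1 (hFC (mem_iUnion₂.2 ⟨x, x.2, hy.1, hyU⟩))
      exact mem_iUnion.2 ⟨i, self_subset_thickening (hr i) _ hi⟩
  refine ⟨Fin.cons (α := fun _ => Set X) (F \ ⋃ i, thickening (r i) (C i))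
    fun i => cthickening (r i) (C i), Fin.cases hremainder hrC, fun x hx => ?_⟩
  by_cases hxC : x ∈ ⋃ i, thickening (r i) (C i)
  · obtain ⟨i, hi⟩ := mem_iUnion.1 hxC
    exact mem_iUnion.2 ⟨i.succ, thickening_subset_cthickening _ _ hi⟩
  · exact mem_iUnion.2 ⟨0, hx, hxC⟩

end FineCovers

section Decomposition

theorem exists_dimH_le_hasFineCovers (n : ℕ) (X : Type u) [MetricSpace X] [CompactSpace X]
    (t : ℝ≥0) (hX : indTopHausdorffDim n X < ((t + n : ℝ) : EReal)) :
    ∃ L : Set X, dimH L ≤ t ∧ ∀ F, IsClosed F → Disjoint F L → HasFineCovers n F := by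
  induction n generalizing X with
  | zero =>
    rw [indTopHausdorffDim, Nat.cast_zero, add_zero] at hX
    refine ⟨univ, dimH_le_of_hausdorffDim_le hX.le, fun F _ hF => ?_⟩
    rw [disjoint_univ.1 hF]
    exact hasFineCovers_empty
  | succ n ih =>
    rw [indTopHausdorffDim] at hX
    split_ifs at hX
    · exact ⟨∅, by simp, fun F _ _ => eq_empty_of_isEmpty F ▸ hasFineCovers_empty⟩
    obtain ⟨d, ⟨B, hB, hBd⟩, hd⟩ := sInf_lt_iff.1 hX
    have hd' : d - 1 < ((t + n : ℝ) : EReal) := by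
      refine EReal.sub_lt_of_lt_add' ?_
      rwa [add_comm, ← EReal.coe_one, ← EReal.coe_add, add_assoc, ← Nat.cast_succ]
    obtain ⟨B', hB'B, hB'c, hB'⟩ := hB.exists_countable
    have hL : ∀ U ∈ B', ∃ L : Set (frontier U), dimH L ≤ t ∧
        ∀ F, IsClosed F → Disjoint F L → HasFineCovers n F := fun U hU => by
      have : CompactSpace (frontier U) := isCompact_iff_compactSpace.1 isClosed_frontier.isCompact
      exact ih (frontier U) ((hBd U (hB'B hU)).trans_lt hd')
    choose! L hLdim hLF using hL
    refine ⟨⋃ U ∈ B', (↑) '' L U, ?_, fun F hF hFL => .succ_of_frontiers hB' hF fun U hU => ?_⟩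
    · rw [dimH_bUnion hB'c]
      refine iSup₂_le fun U hU => ?_
      rw [isometry_subtype_coe.dimH_image]
      exact hLdim U hU
    · rw [inter_comm, ← Subtype.image_preimage_coe]
      refine (hLF U hU _ (hF.preimage continuous_subtype_val) ?_).image_val isClosed_frontier
      exact disjoint_left.2 fun x hx hxL =>
        disjoint_left.1 hFL hx (mem_iUnion₂.2 ⟨U, hU, x, hxL, rfl⟩)

theorem exists_isClosed_hasFineCovers_dimH_compl_le {n : ℕ} {X : Type u} [MetricSpace X]
    [CompactSpace X] {s : ℝ≥0} (hX : indTopHausdorffDim n X ≤ ((s + n : ℝ) : EReal)) :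
    ∃ F : ℕ × ℕ → Set X, (∀ q, IsClosed (F q)) ∧ (∀ q, HasFineCovers n (F q)) ∧
      dimH (⋃ q, F q)ᶜ ≤ s := by
  obtain ⟨t, -, hst, ht⟩ := exists_seq_strictAnti_tendsto s
  have hXt : ∀ k, indTopHausdorffDim n X < ((t k + n : ℝ) : EReal) := fun k =>
    hX.trans_lt (EReal.coe_lt_coe (add_lt_add_left (NNReal.coe_lt_coe.2 (hst k)) _))
  choose L hLdim hLF using fun k => exists_dimH_le_hasFineCovers n X (t k) (hXt k)
  choose H hHG hLH hHdim using fun k => exists_isGδ_superset_dimH_eq (L k)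
  choose O hOo hHO using fun k => isGδ_iff_eq_iInter_nat.1 (hHG k)
  have hclosed : ∀ k m, IsClosed (O k m)ᶜ := fun k m => (hOo k m).isClosed_compl
  have hdisjoint : ∀ k m, Disjoint (O k m)ᶜ (L k) := fun k m =>
    disjoint_compl_left_iff_subset.2 ((hLH k).trans (hHO k ▸ iInter_subset _ m))
  refine ⟨fun q => (O q.1 q.2)ᶜ, fun q => hclosed q.1 q.2,
    fun q => hLF q.1 _ (hclosed q.1 q.2) (hdisjoint q.1 q.2), ?_⟩
  refine ge_of_tendsto' (ENNReal.tendsto_coe.2 ht) fun k => (dimH_mono ?_).trans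
    ((hHdim k).trans_le (hLdim k))
  rw [compl_iUnion, hHO k]
  exact subset_iInter fun m => (iInter_subset _ (k, m)).trans_eq (compl_compl _)

end Decomposition

section AlmostFewToOne

/-- Among any `n + 1` points of `F` at which all functions of the tuple `g` agree, two are closer
than `ε`: the approximation at scale `ε` of the property that the fibres of `g` have at most `n`
points in `F`. -/
def IsAlmostFewToOne {X ι : Type*} [PseudoMetricSpace X] (n : ℕ) (ε : ℝ) (F : Set X)
    (g : ι → C(X, ℝ)) : Prop :=
  ∀ x : Fin (n + 1) → X, (∀ j, x j ∈ F) → (∀ i j k, g i (x j) = g i (x k)) →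
    ∃ j k, j ≠ k ∧ dist (x j) (x k) < ε

theorem isAlmostFewToOne_iUnion {X ι κ : Type*} [PseudoMetricSpace X] {n : ℕ} {ε : ℝ}
    {F : κ → Set X} {g : ι → C(X, ℝ)}
    (hg : ∀ s : Finset κ, IsAlmostFewToOne n ε (⋃ k ∈ s, F k) g) :
    IsAlmostFewToOne n ε (⋃ k, F k) g := fun x hxF => by
  classical
  choose k hk using fun j => mem_iUnion.1 (hxF j)
  exact hg (Finset.univ.image k) x fun j =>
    mem_iUnion₂.2 ⟨k j, Finset.mem_image_of_mem _ (Finset.mem_univ j), hk j⟩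

theorem exists_injective_fin_of_lt_encard {α : Type*} {S : Set α} {n : ℕ} (hS : n < S.encard) :
    ∃ x : Fin (n + 1) → α, Function.Injective x ∧ ∀ j, x j ∈ S := by
  obtain ⟨T, hTS, hT⟩ := exists_subset_encard_eq (Order.add_one_le_of_lt hS)
  lift T to Finset α using finite_of_encard_eq_coe (k := n + 1) (by exact_mod_cast hT)
  have hcard : T.card = n + 1 := by exact_mod_cast (encard_coe_eq_coe_finsetCard T) ▸ hT
  let e := T.equivFinOfCardEq hcard
  exact ⟨fun j => e.symm j, Subtype.val_injective.comp e.symm.injective,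
    fun j => hTS (e.symm j).2⟩

theorem encard_inter_jointFiber_le {X ι : Type*} [MetricSpace X] {n : ℕ} {F : Set X}
    {g : ι → C(X, ℝ)} (hg : ∃ᶠ ε in 𝓝[>] 0, IsAlmostFewToOne n ε F g) (y : ι → ℝ) :
    (F ∩ jointFiber g y).encard ≤ n := by
  by_contra! hcard
  obtain ⟨x, hx, hxF⟩ := exists_injective_fin_of_lt_encard hcard
  have hseparated : ∀ᶠ ε in 𝓝[>] 0, ∀ j k, j ≠ k → ε < dist (x j) (x k) :=
    eventually_all.2 fun j => eventually_all.2 fun k => eventually_imp_distrib_left.2 fun hjk =>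
      nhdsWithin_le_nhds (eventually_lt_nhds (dist_pos.2 (hx.ne hjk)))
  obtain ⟨ε, hε, hsep⟩ := (hg.and_eventually hseparated).exists
  obtain ⟨j, k, hjk, hdist⟩ := hε x (fun j => (hxF j).1)
    fun i j k => ((hxF j).2 i).trans ((hxF k).2 i).symm
  exact (hsep j k hjk).not_gt hdist

theorem isOpen_setOf_isAlmostFewToOne {X ι : Type*} [PseudoMetricSpace X] [CompactSpace X] {n : ℕ}
    {ε : ℝ} {F : Set X} (hF : IsClosed F) :
    IsOpen {g : ι → C(X, ℝ) | IsAlmostFewToOne n ε F g} := by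
  have hclosed : IsClosed {p : (ι → C(X, ℝ)) × (Fin (n + 1) → X) | (∀ j, p.2 j ∈ F) ∧
      (∀ i j k, p.1 i (p.2 j) = p.1 i (p.2 k)) ∧ ∀ j k, j ≠ k → ε ≤ dist (p.2 j) (p.2 k)} := by
    simp only [ofPred_and, ofPred_forall]
    refine (isClosed_iInter fun j => hF.preimage (by fun_prop)).inter
      ((isClosed_iInter fun i => isClosed_iInter fun j => isClosed_iInter fun k => ?_).inter
      (isClosed_iInter fun j => isClosed_iInter fun k => isClosed_iInter fun _ =>
        isClosed_le continuous_const (by fun_prop)))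
    exact isClosed_eq (by fun_prop) (by fun_prop)
  convert (isClosedMap_fst_of_compactSpace _ hclosed).isOpen_compl using 1
  ext g
  simp [IsAlmostFewToOne]

end AlmostFewToOne

theorem exists_injective_forall_abs_sub_le (c : ℕ → ℝ) {η : ℝ} (hη : 0 < η) :
    ∃ c' : ℕ → ℝ, Function.Injective c' ∧ ∀ m, |c' m - c m| ≤ η := by
  let a : ℕ → ℝ := fun m => 1 / ((m : ℝ) + 1)
  have ha : Function.Injective a := fun m k hmk => by simpa [a] using hmk
  -- Two terms of `c + t • a` coincide for at most one `t`.
  have hcount : (⋃ m, ⋃ k, ⋃ _ : m ≠ k, {t | c m + t * a m = c k + t * a k}).Countable := by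
    refine countable_iUnion fun m => countable_iUnion fun k => countable_iUnion fun hmk =>
      Subsingleton.countable fun t ht u hu => ?_
    rw [mem_ofPred_eq] at ht hu
    exact mul_right_cancel₀ (sub_ne_zero.2 (ha.ne hmk)) (by linear_combination ht - hu)
  obtain ⟨t, ⟨ht, htη⟩, htinj⟩ : ∃ t ∈ Ioo 0 η, t ∉ _ := by
    by_contra! hsub
    exact hη.not_ge (Cardinal.Real.Ioo_countable_iff.1 (hcount.mono hsub))
  simp only [mem_iUnion, not_exists] at htinj
  refine ⟨fun m => c m + t * a m, fun m k hmk => ?_, fun m => ?_⟩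
  · by_contra hne
    exact htinj m k hne hmk
  · have ha0 : 0 ≤ a m := Nat.one_div_pos_of_nat.le
    have ha1 : a m ≤ 1 := by simpa [a] using Nat.one_div_le_one_div (α := ℝ) m.zero_le
    rw [add_sub_cancel_left, abs_of_nonneg (mul_nonneg ht.le ha0)]
    exact (mul_le_of_le_one_right ht.le ha1).trans htη.le

section GenericallyFewToOne

variable {X : Type*} [PseudoMetricSpace X] [CompactSpace X] {n : ℕ} {ε : ℝ} {F : Set X}

theorem IsFinelySplit.exists_separating {C : Set X} (hC : IsFinelySplit ε C) {η : ℝ} (hη : 0 < η)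
    {g : C(X, ℝ)} (hg : ∀ x y, dist x y ≤ ε → |g x - g y| ≤ η / 2) :
    ∃ w : C(X, ℝ), ‖w - g‖ ≤ η ∧ ∀ x ∈ C, ∀ y ∈ C, w x = w y → dist x y ≤ ε := by
  obtain ⟨hcl, p, hp, hdist⟩ := hC
  have hvalue : ∀ m, ∃ c : ℝ, ∀ x ∈ C, p x = m → |c - g x| ≤ η / 2 := fun m => by
    by_cases hm : ∃ y ∈ C, p y = m
    · obtain ⟨y, hy, rfl⟩ := hm
      exact ⟨g y, fun x hx hxy => hg y x (hdist y hy x hx hxy.symm)⟩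
    · exact ⟨0, fun x hx hxm => absurd ⟨x, hx, hxm⟩ hm⟩
  choose c hc using hvalue
  obtain ⟨c', hinj, hc'⟩ := exists_injective_forall_abs_sub_le c (half_pos hη)
  obtain ⟨u, hu⟩ := ContinuousMap.exists_restrict_eq hcl
    ⟨C.domRestrict (c' ∘ p), (continuous_of_discreteTopology.comp_continuousOn hp).domRestrict⟩
  have huC : ∀ x ∈ C, u x = c' (p x) := fun x hx => DFunLike.congr_fun hu ⟨x, hx⟩
  obtain ⟨w, hw, hwu⟩ := exists_continuousMap_truncate hη.le u g
  have hwC : ∀ x ∈ C, w x = c' (p x) := fun x hx => by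
    rw [← huC x hx]
    refine hwu x ?_
    rw [huC x hx]
    linarith [hc' (p x), hc (p x) x hx rfl, abs_sub_le (c' (p x)) (c (p x)) (g x)]
  refine ⟨w, hw, fun x hx y hy hxy => hdist x hx y hy (hinj ?_)⟩
  rw [← hwC x hx, ← hwC y hy, hxy]

theorem dense_setOf_isAlmostFewToOne (hF : HasFineCovers n F) (hε : 0 < ε) :
    Dense {g : Fin n → C(X, ℝ) | IsAlmostFewToOne n ε F g} := by
  refine Metric.dense_iff.2 fun g η hη => ?_
  obtain ⟨ρ, hρ, hgρ⟩ := Metric.uniformContinuous_iff.1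
    (CompactSpace.uniformContinuous_of_continuous (f := fun x i => g i x) (by fun_prop)) (η / 4)
    (by positivity)
  obtain ⟨σ, hσ, hσρε⟩ := exists_between (lt_min hρ hε)
  obtain ⟨hσρ, hσε⟩ := lt_min_iff.1 hσρε
  obtain ⟨C, hC, hFC⟩ := hF σ hσ
  have hosc : ∀ i x y, dist x y ≤ σ → |g i x - g i y| ≤ η / 2 / 2 := fun i x y hxy => by
    have hlt := (dist_le_pi_dist _ _ i).trans_lt (hgρ (hxy.trans_lt hσρ))
    exact hlt.le.trans (by linarith)
  choose w hw hwC using fun i => (hC i).exists_separating (half_pos hη) (hosc i)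
  refine ⟨w, ?_, fun x hxF hx => ?_⟩
  · rw [mem_ball, dist_eq_norm]
    exact ((pi_norm_le_iff_of_nonneg (by positivity)).2 hw).trans_lt (half_lt_self hη)
  -- By the pigeonhole principle two of the `n + 1` points lie in the same `C i`.
  choose i hi using fun j => mem_iUnion.1 (hFC (hxF j))
  obtain ⟨j, k, hjk, hijk⟩ := Fintype.exists_ne_map_eq_of_card_lt i (by simp)
  exact ⟨j, k, hjk, (hwC (i j) _ (hi j) _ (hijk ▸ hi k) (hx _ _ _)).trans_lt hσε⟩

end GenericallyFewToOne

section SmallFibers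

variable {X : Type u} [MetricSpace X] [CompactSpace X] {n : ℕ}

theorem eventually_residual_encard_iUnion_inter_jointFiber_le {κ : Type*} [Countable κ]
    {F : κ → Set X} (hF : ∀ k, IsClosed (F k)) (hcov : ∀ k, HasFineCovers n (F k)) :
    ∀ᶠ g : Fin n → C(X, ℝ) in residual _, ∀ y, ((⋃ k, F k) ∩ jointFiber g y).encard ≤ n := by
  obtain ⟨u, -, hu0, hu⟩ := exists_seq_strictAnti_tendsto' (zero_lt_one' ℝ)
  have hgeneric : ∀ m (s : Finset κ), ∀ᶠ g : Fin n → C(X, ℝ) in residual _,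
      IsAlmostFewToOne n (u m) (⋃ k ∈ s, F k) g := fun m s =>
    residual_of_dense_open
      (isOpen_setOf_isAlmostFewToOne (s.finite_toSet.isClosed_biUnion fun k _ => hF k))
      (dense_setOf_isAlmostFewToOne (.biUnion s fun k _ => hcov k) (hu0 m).1)
  filter_upwards [eventually_countable_forall.2 fun m => eventually_countable_forall.2 (hgeneric m)]
    with g hg y
  have hu' : Tendsto u atTop (𝓝[>] 0) :=
    tendsto_nhdsWithin_iff.2 ⟨hu, .of_forall fun m => (hu0 m).1⟩
  exact encard_inter_jointFiber_le
    (hu'.frequently (Frequently.of_forall fun m => isAlmostFewToOne_iUnion (hg m))) y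

theorem exists_nnreal_add_natCast_eq {D : EReal} (hD : (n : EReal) ≤ D) (htop : D ≠ ⊤) :
    ∃ s : ℝ≥0, D = ((s + n : ℝ) : EReal) := by
  lift D to ℝ using ⟨htop, ne_bot_of_le_ne_bot (EReal.natCast_ne_bot n) hD⟩
  have hn : (n : ℝ) ≤ D := EReal.coe_le_coe_iff.1 hD
  exact ⟨⟨D - n, sub_nonneg.2 hn⟩, congrArg Real.toEReal (sub_add_cancel D (n : ℝ)).symm⟩

theorem exists_isGδ_eventually_residual_encard_le [Nonempty X]
    (hX : (n : EReal) ≤ indTopHausdorffDim n X) :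
    ∃ G : Set X, IsGδ G ∧ G.Nonempty ∧ hausdorffDim G ≤ indTopHausdorffDim n X - (n : EReal) ∧
      ∀ᶠ g : Fin n → C(X, ℝ) in residual _, ∀ y, (jointFiber g y \ G).encard ≤ n := by
  rcases eq_or_ne (indTopHausdorffDim n X) ⊤ with htop | htop
  · refine ⟨univ, .univ, univ_nonempty, ?_, .of_forall fun g y => by simp⟩
    rw [htop, ← EReal.coe_natCast, EReal.top_sub_coe]
    exact le_top
  obtain ⟨s, hs⟩ := exists_nnreal_add_natCast_eq hX htop
  obtain ⟨F, hF, hcov, hdim⟩ := exists_isClosed_hasFineCovers_dimH_compl_le hs.le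
  obtain ⟨x₀⟩ := ‹Nonempty X›
  have hGδ : IsGδ (⋃ q, F q)ᶜ := by
    rw [compl_iUnion]
    exact .iInter fun q => (hF q).isOpen_compl.isGδ
  refine ⟨(⋃ q, F q)ᶜ ∪ {x₀}, hGδ.union (.singleton x₀), ⟨x₀, .inr rfl⟩, ?_, ?_⟩
  · rw [hausdorffDim_of_nonempty ⟨x₀, .inr rfl⟩, hs, ← EReal.coe_natCast, ← EReal.coe_sub,
      add_sub_cancel_right, dimH_union, dimH_singleton, max_eq_left zero_le]
    exact EReal.coe_ennreal_le_coe_ennreal_iff.2 hdim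
  · filter_upwards [eventually_residual_encard_iUnion_inter_jointFiber_le hF hcov] with g hg y
    refine (encard_le_encard ?_).trans (hg y)
    exact fun x hx => ⟨not_not.1 fun hxF => hx.2 (.inl hxF), hx.1⟩

end SmallFibers

theorem hausdorffDim_eq_indTopHausdorffDim_sub {X : Type u} [MetricSpace X] [CompactSpace X]
    {n : ℕ} (hX : (n : EReal) ≤ indTopHausdorffDim n X) {G : Set X} (hG : G.Nonempty)
    (hle : hausdorffDim G ≤ indTopHausdorffDim n X - (n : EReal))
    (hfew : ∀ᶠ g : Fin n → C(X, ℝ) in residual _, ∀ y, (jointFiber g y \ G).encard ≤ n) :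
    hausdorffDim G = indTopHausdorffDim n X - (n : EReal) := by
  refine hle.antisymm ?_
  obtain ⟨g, hgfew, hglarge⟩ := (dense_of_mem_residual
    (hfew.and (eventually_residual_le_hausdorffDim_jointFiber hX))).nonempty
  have hsub : ∀ D : EReal, D - (n : EReal) ≤ hausdorffDim G ↔ D ≤ hausdorffDim G + (n : EReal) :=
    fun _ => EReal.sub_le_iff_le_add (.inl (EReal.natCast_ne_bot n)) (.inl (EReal.natCast_ne_top n))
  refine (hsub _).2 (EReal.ge_of_forall_gt_iff_ge.1 fun d hd => (hsub d).1 ?_)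
  obtain ⟨c, hc⟩ := hglarge d hd
  exact hc.self_of_nhds.trans
    (hausdorffDim_le_of_finite_diff hG (finite_of_encard_le_coe (hgfew c)))

section EuclideanCoordinates

/-- A continuous map into Euclidean space is the tuple of its coordinates: this turns generic maps
into generic tuples of real functions. -/
def euclideanCoordinates (X : Type*) [TopologicalSpace X] [LocallyCompactSpace X] (n : ℕ) :
    C(X, EuclideanSpace ℝ (Fin n)) ≃ₜ (Fin n → C(X, ℝ)) where
  toFun f i := ⟨fun x => f x i, by fun_prop⟩
  invFun g := ⟨fun x => WithLp.toLp 2 fun i => g i x, by fun_prop⟩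
  left_inv _ := rfl
  right_inv _ := rfl
  continuous_toFun := continuous_pi fun i => ContinuousMap.continuous_of_continuous_uncurry _ <|
    (PiLp.continuous_apply 2 _ i).comp (continuous_fst.eval continuous_snd)
  continuous_invFun := ContinuousMap.continuous_of_continuous_uncurry _ <|
    (PiLp.continuous_toLp 2 _).comp <| continuous_pi fun i =>
      ((continuous_apply i).comp continuous_fst).eval continuous_snd

variable {X : Type*} [TopologicalSpace X] [LocallyCompactSpace X] {n : ℕ}

theorem jointFiber_euclideanCoordinates (f : C(X, EuclideanSpace ℝ (Fin n)))
    (y : EuclideanSpace ℝ (Fin n)) : jointFiber (euclideanCoordinates X n f) y = f ⁻¹' {y} := by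
  ext x
  exact ⟨fun hx => PiLp.ext hx, fun hx i => congrArg (· i) hx⟩

theorem eventually_residual_euclideanCoordinates {P : (Fin n → C(X, ℝ)) → Prop}
    (hP : ∀ᶠ g in residual _, P g) :
    ∀ᶠ f in residual C(X, EuclideanSpace ℝ (Fin n)), P (euclideanCoordinates X n f) := by
  rw [← (euclideanCoordinates X n).residual_map_eq] at hP
  exact hP

end EuclideanCoordinates

theorem exists_forall_mem_ball_of_eventually_nhds {n : ℕ} {P : (Fin n → ℝ) → Prop} {c : Fin n → ℝ}
    (hc : ∀ᶠ y in 𝓝 c, P y) :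
    ∃ (c : EuclideanSpace ℝ (Fin n)) (r : ℝ), 0 < r ∧ ∀ y ∈ ball c r, P y :=
  ⟨WithLp.toLp 2 c, Metric.eventually_nhds_iff_ball.1
    ((PiLp.continuous_ofLp 2 _).continuousAt.eventually hc)⟩

theorem theorem6p9 (n : ℕ) (hn : 0 < n) (K : Type u) [MetricSpace K] [CompactSpace K]
    (hK : (n : WithBot ℕ∞) ≤ smallInductiveDimension K) :
    ∃ G : Set K, IsGδ G ∧ hausdorffDim G = indTopHausdorffDim n K - (n : EReal) ∧
      ∀ᶠ f : C(K, EuclideanSpace ℝ (Fin n)) in residual C(K, EuclideanSpace ℝ (Fin n)),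
        (∀ y : EuclideanSpace ℝ (Fin n), ((f ⁻¹' {y}) \ G).encard ≤ (n : ℕ∞)) ∧
        (∀ y : EuclideanSpace ℝ (Fin n),
          hausdorffDim (f ⁻¹' {y}) ≤ indTopHausdorffDim n K - (n : EReal)) ∧
        (∀ d : ℝ, (d : EReal) < indTopHausdorffDim n K →
          ∃ (c : EuclideanSpace ℝ (Fin n)) (r : ℝ), 0 < r ∧
            ∀ y ∈ Metric.ball c r, (d : EReal) - (n : EReal) ≤ hausdorffDim (f ⁻¹' {y})) := by
  have hD := natCast_le_indTopHausdorffDim hK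
  have : Nonempty K := by
    by_contra! hempty
    simp [smallInductiveDimension_of_isEmpty] at hK
  obtain ⟨G, hGδ, hGne, hGle, hfew⟩ := exists_isGδ_eventually_residual_encard_le hD
  have hGdim := hausdorffDim_eq_indTopHausdorffDim_sub hD hGne hGle hfew
  refine ⟨G, hGδ, hGdim, ?_⟩
  filter_upwards [eventually_residual_euclideanCoordinates
    (hfew.and (eventually_residual_le_hausdorffDim_jointFiber hD))] with f ⟨hffew, hflarge⟩
  simp only [← jointFiber_euclideanCoordinates, ← hGdim]
  refine ⟨fun y => hffew y, fun y => ?_, fun d hd => ?_⟩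
  · exact hausdorffDim_le_of_finite_diff hGne (finite_of_encard_le_coe (hffew y))
  · obtain ⟨c, hc⟩ := hflarge d hd
    exact exists_forall_mem_ball_of_eventually_nhds hc
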